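/- Let $d\ge 1$. For $j=1,\dots,d$ let $p_j,q_j$ be continuously differentiable functions on $[0,1]$ that are positive on $(0,1)$, with $p_j/q_j$ strictly increasing on $(0,1)$, and suppose that there are a continuously differentiable function $u_j$ and a continuous function $v_j$ on $(0,1)$ such that $f=p_j$ and $f=q_j$ both satisfy the Sturm–Liouville equation $$\frac{\mathrm d}{\mathrm dx}\Bigl(u_j(x)\frac{\mathrm df}{\mathrm dx}(x)\Bigr)+v_j(x)f(x)=0,\qquad x\in(0,1).$$ Let $\{\mathsf Y(\boldsymbol x):\boldsymbol x\in(0,1)^d\}$ be a zero-mean Gaussian process with the tensor Markov kernel $$k(\boldsymbol x,\boldsymbol x')=\prod_{j=1}^d p_j\bigl(\min(x_j,x_j')\bigr)\,q_j\bigl(\max(x_j,x_j')\bigr).$$ For $l\ge1$ put $\mathcal X_l=\{i\,2^{-l}:1\le i\le 2^l-1\}$, and for $\tau\ge 1$ let the sparse grid of level $\tau$ be $$\mathcal X^{\mathsf{SG}}_\tau=\bigcup_{\boldsymbol l\in\{1,2,\dots\}^d,\;l_1+\dots+l_d\le\tau+d-1}\mathcal X_{l_1}\times\dots\times\mathcal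 X_{l_d}.$$ A truncated sparse grid (TSG) of size $n$ is a set $\mathcal X^{\mathsf{SG}}_\tau\cup\mathcal A$, where $\tau\ge1$ satisfies $|\mathcal X^{\mathsf{SG}}_\tau|\le n<|\mathcal X^{\mathsf{SG}}_{\tau+1}|$ and $\mathcal A$ is an arbitrary set of $n-|\mathcal X^{\mathsf{SG}}_\tau|$ points of $\mathcal X^{\mathsf{SG}}_{\tau+1}\setminus\mathcal X^{\mathsf{SG}}_\tau$. For a TSG $\{\boldsymbol x_1,\dots,\boldsymbol x_n\}$ of size $n$ on which $\mathsf Y$ is observed without noise, let $\widehat{\mathsf Y}_n(\boldsymbol x)=\boldsymbol k(\boldsymbol x)^{\top}\boldsymbol K^{-1}\boldsymbol y$ be the kriging predictor, where $\boldsymbol k(\boldsymbol x)=(k(\boldsymbol x,\boldsymbol x_i))_{i}$, $\boldsymbol K=(k(\boldsymbol x_i,\boldsymbol x_{i'}))_{i,i'}$ and $\boldsymbol y=(\mathsf Y(\boldsymbol x_i))_{i}$. Then, as $n\to\infty$, $$\sup_{\boldsymbol x\in(0,1)^d}\mathbb E\bigl[(\widehat{\mathsf Y}_n(\boldsymbol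 x)-\mathsf Y(\boldsymbol x))^2\bigr]=\mathcal O\bigl(n^{-1}(\log n)^{2(d-1)}\bigr),$$ with a constant that may depend on $d$ and on the kernel, but not on the choice of the points in $\mathcal A$. -/

import Mathlib

open MeasureTheory ProbabilityTheory
open scoped Matrix ENNReal

namespace TensorMarkov

/-- The design space `(0,1)^d`. -/
def openCube (d : ℕ) : Set (Fin d → ℝ) := {x | ∀ j, x j ∈ Set.Ioo (0 : ℝ) 1}

/-- The kernel `k(x, x') = ∏ j, p_j (x_j ∧ x'_j) * q_j (x_j ∨ x'_j)`. -/
def tmKernel {d : ℕ} (p q : Fin d → ℝ → ℝ) (x x' : Fin d → ℝ) : ℝ :=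
  ∏ j, p j (min (x j) (x' j)) * q j (max (x j) (x' j))

/-- The conditions on `p_j`, `q_j` under which `tmKernel p q` is a tensor Markov kernel on
`(0,1)^d`: positivity, and `p_j / q_j` strictly increasing. -/
structure IsTensorMarkov {d : ℕ} (p q : Fin d → ℝ → ℝ) : Prop where
  p_pos : ∀ j, ∀ x ∈ Set.Ioo (0 : ℝ) 1, 0 < p j x
  q_pos : ∀ j, ∀ x ∈ Set.Ioo (0 : ℝ) 1, 0 < q j x
  strictMono_div : ∀ j, StrictMonoOn (fun x => p j x / q j x) (Set.Ioo 0 1)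

/-- `f` solves the Sturm–Liouville equation `(u f')' + v f = 0` on `(0,1)`; in particular `u f'`
is differentiable there. -/
def SolvesSturmLiouville (u v f : ℝ → ℝ) : Prop :=
  ∀ x ∈ Set.Ioo (0 : ℝ) 1, HasDerivAt (fun y => u y * deriv f y) (-(v x * f x)) x

/-- Sturm–Liouville regularity: `p_j` and `q_j` are continuously differentiable (up to the
boundary) and both solve one equation `(u_j f')' + v_j f = 0` on `(0,1)`, with `u_j` continuously
differentiable and `v_j` continuous on `(0,1)`. -/
structure SturmLiouvilleRegular {d : ℕ} (p q : Fin d → ℝ → ℝ) : Prop where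
  contDiffOn_p : ∀ j, ContDiffOn ℝ 1 (p j) (Set.Icc 0 1)
  contDiffOn_q : ∀ j, ContDiffOn ℝ 1 (q j) (Set.Icc 0 1)
  ode : ∀ j, ∃ u v : ℝ → ℝ, ContDiffOn ℝ 1 u (Set.Ioo 0 1) ∧ ContinuousOn v (Set.Ioo 0 1) ∧
    SolvesSturmLiouville u v (p j) ∧ SolvesSturmLiouville u v (q j)

/-- `Y`, restricted to `(0,1)^d`, is a zero-mean Gaussian process with covariance kernel `k`. The
values of `Y` outside `(0,1)^d` play no role. -/
structure IsCenteredGP {d : ℕ} {Ω : Type*} [MeasurableSpace Ω] (Y : (Fin d → ℝ) → Ω → ℝ)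
    (k : (Fin d → ℝ) → (Fin d → ℝ) → ℝ) (P : Measure Ω) : Prop where
  gaussian : IsGaussianProcess (fun x : openCube d => Y x) P
  mean_zero : ∀ x ∈ openCube d, ∫ ω, Y x ω ∂P = 0
  cov_eq : ∀ x ∈ openCube d, ∀ x' ∈ openCube d, covariance (Y x) (Y x') P = k x x'

/-- The dyadic one-dimensional design `{i * 2^(-l) : 1 ≤ i ≤ 2^l - 1}` (empty for `l = 0`). -/
noncomputable def dyadicDesign (l : ℕ) : Finset ℝ :=
  (Finset.Icc 1 (2 ^ l - 1)).image fun i : ℕ => (i : ℝ) / 2 ^ l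

/-- The classical sparse grid of level `τ`: the union of the lattices
`dyadicDesign (l 1) × ⋯ × dyadicDesign (l d)` over `l` with all `l j ≥ 1` and
`l 1 + ⋯ + l d ≤ τ + d - 1`. -/
noncomputable def sparseGrid (d τ : ℕ) : Finset (Fin d → ℝ) :=
  ((Fintype.piFinset fun _ : Fin d => Finset.Icc 1 (τ + d - 1)).filter
      fun l => ∑ j, l j ≤ τ + d - 1).biUnion
    fun l => Fintype.piFinset fun j => dyadicDesign (l j)

/-- `D` is a truncated sparse grid of size `n`: with `τ ≥ 1` such that
`|sparseGrid τ| ≤ n < |sparseGrid (τ+1)|`, it consists of `sparseGrid τ` and an arbitrary choice of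
`n - |sparseGrid τ|` points of `sparseGrid (τ+1) \ sparseGrid τ`. -/
def IsTruncatedSparseGrid (d n : ℕ) (D : Finset (Fin d → ℝ)) : Prop :=
  ∃ τ : ℕ, 1 ≤ τ ∧ (sparseGrid d τ).card ≤ n ∧ n < (sparseGrid d (τ + 1)).card ∧
    ∃ A : Finset (Fin d → ℝ), A ⊆ sparseGrid d (τ + 1) \ sparseGrid d τ ∧
      A.card = n - (sparseGrid d τ).card ∧ D = sparseGrid d τ ∪ A

/-- The kernel matrix of `k` on the design `D`. -/
def kernelMatrix {d : ℕ} (k : (Fin d → ℝ) → (Fin d → ℝ) → ℝ) (D : Finset (Fin d → ℝ)) :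
    Matrix D D ℝ := Matrix.of fun a b => k a b

/-- The kriging predictor `k(x)ᵀ K⁻¹ y` from the noiseless observations `y` of `Y` on `D`. -/
noncomputable def krigingPredictor {d : ℕ} {Ω : Type*} (k : (Fin d → ℝ) → (Fin d → ℝ) → ℝ)
    (D : Finset (Fin d → ℝ)) (Y : (Fin d → ℝ) → Ω → ℝ) (x : Fin d → ℝ) (ω : Ω) : ℝ :=
  (fun a : D => k x a) ⬝ᵥ ((kernelMatrix k D)⁻¹ *ᵥ fun a : D => Y a ω)

/-- The mean squared error `E[(Ŷ(x) - Y(x))²]` of the kriging predictor, in `[0, ∞]`. -/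
noncomputable def krigingMSE {d : ℕ} {Ω : Type*} [MeasurableSpace Ω]
    (k : (Fin d → ℝ) → (Fin d → ℝ) → ℝ) (D : Finset (Fin d → ℝ)) (Y : (Fin d → ℝ) → Ω → ℝ)
    (P : Measure Ω) (x : Fin d → ℝ) : ℝ≥0∞ :=
  ∫⁻ ω, ENNReal.ofReal ((krigingPredictor k D Y x ω - Y x ω) ^ 2) ∂P

end TensorMarkov

/-!
The kernel is a product of one-dimensional Markov kernels, each the Gram kernel of a feature map `φ`
into `L²(ℝ)`, and the kriging predictor is the orthogonal projection onto the span of the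
observations, so its error is at most the distance from the feature `ψ x = Y x` of `x` to any vector
of that span. In one dimension `‖φ a - φ b‖²` is at most a multiple of `|a - b|`, so projecting onto
the spans of the nested dyadic designs splits `φ a` into orthogonal increments, the one of level `l`
having squared norm `O(2⁻ˡ)`. Multiplying these splittings over the coordinates gives an orthogonal
expansion of `ψ x`; the terms of total level below `τ` lie in the span of the sparse grid, and the
others have total squared norm of order `τ^(d-1) * 2^(-τ)`. Finally, a truncated sparse grid
containing the sparse grid of level `τ` has `n` points with `2^τ - 1 ≤ n` and
`n = O(τ^(d-1) * 2^τ)`.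
-/

namespace TensorMarkov

section Counting

theorem card_antidiagonalTuple_le (d m : ℕ) :
    (Finset.Nat.antidiagonalTuple d m).card ≤ (m + 1) ^ (d - 1) := by
  cases d with
  | zero => cases m <;> simp
  | succ e =>
    have hbox : (Fintype.piFinset fun _ : Fin e => Finset.range (m + 1)).card = (m + 1) ^ e := by
      simp
    rw [Nat.add_sub_cancel, ← hbox]
    refine Finset.card_le_card_of_injOn Fin.tail (fun l hl => ?_) fun l hl l' hl' htail => ?_
    all_goals simp only [Finset.mem_coe, Finset.Nat.mem_antidiagonalTuple, Fin.sum_univ_succ] at hl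
    · refine Fintype.mem_piFinset.2 fun i => Finset.mem_range.2 ?_
      have hi : l i.succ ≤ ∑ i : Fin e, l i.succ :=
        Finset.single_le_sum (f := fun i : Fin e => l i.succ) (fun _ _ => Nat.zero_le _)
          (Finset.mem_univ i)
      simp only [Fin.tail]
      omega
    · simp only [Finset.mem_coe, Finset.Nat.mem_antidiagonalTuple, Fin.sum_univ_succ] at hl'
      have hsucc : ∀ i : Fin e, l i.succ = l' i.succ := congrFun htail
      simp only [hsucc] at hl
      exact funext (Fin.cases (by omega) hsucc)

theorem sum_apply_sum_le {R : Type*} [Semiring R] [PartialOrder R] [IsOrderedRing R] {d : ℕ}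
    {s : Finset (Fin d → ℕ)} {T : Finset ℕ} (hT : ∀ l ∈ s, ∑ j, l j ∈ T) {f : ℕ → R}
    (hf : ∀ m, 0 ≤ f m) :
    ∑ l ∈ s, f (∑ j, l j) ≤ ∑ m ∈ T, ((m : R) + 1) ^ (d - 1) * f m := by
  rw [← Finset.sum_fiberwise_of_maps_to hT]
  refine Finset.sum_le_sum fun m _ => ?_
  have hfiber : s.filter (fun l => ∑ j, l j = m) ⊆ Finset.Nat.antidiagonalTuple d m :=
    fun l hl => Finset.Nat.mem_antidiagonalTuple.2 (Finset.mem_filter.1 hl).2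
  have hcard : ((s.filter fun l => ∑ j, l j = m).card : R) ≤ ((m : R) + 1) ^ (d - 1) := by
    exact_mod_cast Nat.mono_cast
      ((Finset.card_le_card hfiber).trans (card_antidiagonalTuple_le d m))
  rw [Finset.sum_congr rfl fun l hl => by rw [(Finset.mem_filter.1 hl).2], Finset.sum_const,
    nsmul_eq_mul]
  exact mul_le_mul_of_nonneg_right hcard (hf m)

theorem summable_add_one_pow_mul_half_pow (e : ℕ) :
    Summable fun i : ℕ => ((i : ℝ) + 1) ^ e * (1 / 2 : ℝ) ^ i := by
  have h := (summable_nat_add_iff 1).2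
    (summable_pow_mul_geometric_of_norm_lt_one e (r := (1 / 2 : ℝ)) (by norm_num))
  refine (h.mul_left 2).congr fun i => ?_
  push_cast
  ring

theorem exists_sum_half_pow_sum_le (d : ℕ) : ∃ C : ℝ, 0 ≤ C ∧
    ∀ (t : ℕ) (s : Finset (Fin d → ℕ)), (∀ l ∈ s, t ≤ ∑ j, l j) →
      ∑ l ∈ s, (1 / 2 : ℝ) ^ (∑ j, l j) ≤ C * ((t : ℝ) + 1) ^ (d - 1) * (1 / 2) ^ t := by
  have hsum := summable_add_one_pow_mul_half_pow (d - 1)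
  set a : ℕ → ℝ := fun i => ((i : ℝ) + 1) ^ (d - 1) * (1 / 2 : ℝ) ^ i
  have ha : ∀ i, 0 ≤ a i := fun i => by positivity
  refine ⟨∑' i, a i, tsum_nonneg ha, fun t s hs => ?_⟩
  set N := s.sup fun l => ∑ j, l j
  have hT : ∀ l ∈ s, ∑ j, l j ∈ Finset.Ico t (N + 1) := fun l hl => Finset.mem_Ico.2
    ⟨hs l hl, Nat.lt_succ_iff.2 (Finset.le_sup (f := fun l : Fin d → ℕ => ∑ j, l j) hl)⟩
  have hterm : ∀ i : ℕ, (((t + i : ℕ) : ℝ) + 1) ^ (d - 1) * (1 / 2) ^ (t + i)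
      ≤ ((t : ℝ) + 1) ^ (d - 1) * (1 / 2) ^ t * a i := by
    intro i
    have hti : ((t + i : ℕ) : ℝ) + 1 ≤ ((t : ℝ) + 1) * (i + 1) := by
      push_cast
      nlinarith [mul_nonneg (Nat.cast_nonneg (α := ℝ) t) (Nat.cast_nonneg (α := ℝ) i)]
    calc _ ≤ (((t : ℝ) + 1) * (i + 1)) ^ (d - 1) * (1 / 2) ^ (t + i) := by gcongr
      _ = _ := by rw [mul_pow, pow_add]; ring
  calc ∑ l ∈ s, (1 / 2 : ℝ) ^ (∑ j, l j)
      ≤ ∑ m ∈ Finset.Ico t (N + 1), ((m : ℝ) + 1) ^ (d - 1) * (1 / 2) ^ m :=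
        sum_apply_sum_le hT fun m => by positivity
    _ = ∑ i ∈ Finset.range (N + 1 - t), (((t + i : ℕ) : ℝ) + 1) ^ (d - 1) * (1 / 2) ^ (t + i) :=
        Finset.sum_Ico_eq_sum_range _ _ _
    _ ≤ ∑ i ∈ Finset.range (N + 1 - t), ((t : ℝ) + 1) ^ (d - 1) * (1 / 2) ^ t * a i :=
        Finset.sum_le_sum fun i _ => hterm i
    _ = ((t : ℝ) + 1) ^ (d - 1) * (1 / 2) ^ t * ∑ i ∈ Finset.range (N + 1 - t), a i :=
        (Finset.mul_sum ..).symm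
    _ ≤ ((t : ℝ) + 1) ^ (d - 1) * (1 / 2) ^ t * ∑' i, a i := by
        gcongr
        exact hsum.sum_le_tsum _ fun i _ => ha i
    _ = _ := by ring

end Counting

section SparseGrid

variable {d l τ n : ℕ} {x : ℝ}

theorem card_dyadicDesign (l : ℕ) : (dyadicDesign l).card = 2 ^ l - 1 := by
  have hinj : Function.Injective fun i : ℕ => (i : ℝ) / 2 ^ l := fun i i' h =>
    Nat.cast_injective ((div_left_inj' (by positivity)).1 h)
  rw [dyadicDesign, Finset.card_image_of_injective _ hinj, Nat.card_Icc, Nat.add_sub_cancel]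

theorem dyadicDesign_zero : dyadicDesign 0 = ∅ := by
  simp [dyadicDesign]

theorem half_mem_dyadicDesign_one : (1 / 2 : ℝ) ∈ dyadicDesign 1 := by
  simp [dyadicDesign]

theorem dyadicDesign_subset_Ioo (l : ℕ) : (dyadicDesign l : Set ℝ) ⊆ Set.Ioo 0 1 := by
  intro x hx
  obtain ⟨i, hi, rfl⟩ := Finset.mem_image.1 (Finset.mem_coe.1 hx)
  rw [Finset.mem_Icc] at hi
  have hpos : (0 : ℝ) < 2 ^ l := by positivity
  have hlt : i < 2 ^ l := by have := Nat.one_le_two_pow (n := l); omega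
  exact ⟨div_pos (by exact_mod_cast hi.1) hpos, (div_lt_one hpos).2 (by exact_mod_cast hlt)⟩

theorem dyadicDesign_mono : Monotone dyadicDesign := by
  refine monotone_nat_of_le_succ fun l x hx => ?_
  obtain ⟨i, hi, rfl⟩ := Finset.mem_image.1 hx
  rw [Finset.mem_Icc] at hi
  refine Finset.mem_image.2 ⟨2 * i, Finset.mem_Icc.2 ⟨by omega, by rw [pow_succ]; omega⟩, ?_⟩
  push_cast
  rw [pow_succ]
  field_simp

theorem exists_mem_dyadicDesign_abs_sub_le (hl : 1 ≤ l) (hx : x ∈ Set.Ioo (0 : ℝ) 1) :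
    ∃ a ∈ dyadicDesign l, |x - a| ≤ (1 / 2) ^ l := by
  have hpos : (0 : ℝ) < 2 ^ l := by positivity
  have hx0 : 0 ≤ x * 2 ^ l := mul_nonneg hx.1.le hpos.le
  have hfloor_lt : ⌊x * 2 ^ l⌋₊ < 2 ^ l := by
    rw [Nat.floor_lt hx0]
    push_cast
    nlinarith [hx.2]
  have htwo_le : 2 ≤ 2 ^ l := Nat.le_self_pow (by omega) 2
  set i := max 1 ⌊x * 2 ^ l⌋₊
  have hi : |x * 2 ^ l - i| ≤ 1 := by
    have hfloor_le := Nat.floor_le hx0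
    have hlt_floor := Nat.lt_floor_add_one (x * 2 ^ l)
    rw [Nat.cast_max, Nat.cast_one, abs_le]
    rcases le_total (1 : ℝ) (⌊x * 2 ^ l⌋₊ : ℝ) with h | h
    · rw [max_eq_right h]; constructor <;> linarith
    · rw [max_eq_left h]; constructor <;> linarith
  refine ⟨i / 2 ^ l, Finset.mem_image_of_mem _ (Finset.mem_Icc.2 ⟨le_max_left _ _, by omega⟩), ?_⟩
  calc |x - i / 2 ^ l| = |x * 2 ^ l - i| / 2 ^ l := by
        rw [← abs_of_pos hpos, ← abs_div, abs_of_pos hpos, sub_div,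
          mul_div_cancel_right₀ _ hpos.ne']
    _ ≤ 1 / 2 ^ l := by gcongr
    _ = (1 / 2) ^ l := (one_div_pow _ _).symm

theorem mem_sparseGrid {x : Fin d → ℝ} : x ∈ sparseGrid d τ ↔
    ∃ l : Fin d → ℕ, (∀ j, 1 ≤ l j) ∧ ∑ j, l j ≤ τ + d - 1 ∧ ∀ j, x j ∈ dyadicDesign (l j) := by
  simp only [sparseGrid, Finset.mem_biUnion, Finset.mem_filter, Fintype.mem_piFinset,
    Finset.mem_Icc]
  refine ⟨fun ⟨l, ⟨hl, hsum⟩, hx⟩ => ⟨l, fun j => (hl j).1, hsum, hx⟩,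
    fun ⟨l, hl, hsum, hx⟩ => ⟨l, ⟨fun j => ⟨hl j, ?_⟩, hsum⟩, hx⟩⟩
  exact (Finset.single_le_sum (fun _ _ => Nat.zero_le _) (Finset.mem_univ j)).trans hsum

theorem mem_sparseGrid_of_sum_lt {x : Fin d → ℝ} {l : Fin d → ℕ} (hl : ∑ j, l j < τ)
    (hx : ∀ j, x j ∈ dyadicDesign (l j + 1)) : x ∈ sparseGrid d τ := by
  refine mem_sparseGrid.2 ⟨fun j => l j + 1, fun j => Nat.le_add_left 1 _, ?_, hx⟩
  simp only [Finset.sum_add_distrib, Finset.sum_const, Finset.card_univ, Fintype.card_fin,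
    smul_eq_mul, mul_one]
  omega

theorem sparseGrid_subset_openCube (d τ : ℕ) :
    (sparseGrid d τ : Set (Fin d → ℝ)) ⊆ openCube d := fun _ hx j =>
  let ⟨l, _, _, h⟩ := mem_sparseGrid.1 (Finset.mem_coe.1 hx)
  dyadicDesign_subset_Ioo (l j) (h j)

theorem IsTruncatedSparseGrid.subset_openCube {D : Finset (Fin d → ℝ)}
    (hD : IsTruncatedSparseGrid d n D) : (D : Set (Fin d → ℝ)) ⊆ openCube d := by
  obtain ⟨τ, -, -, -, A, hA, -, rfl⟩ := hD
  rw [Finset.coe_union]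
  exact Set.union_subset (sparseGrid_subset_openCube d τ) fun a ha =>
    sparseGrid_subset_openCube d (τ + 1) (Finset.mem_sdiff.1 (hA ha)).1

theorem card_sparseGrid_succ_le (d τ : ℕ) :
    (sparseGrid d (τ + 1)).card ≤ (τ + d + 1) ^ (d - 1) * 2 ^ (τ + d + 1) := by
  refine Finset.card_biUnion_le.trans ?_
  set s := (Fintype.piFinset fun _ : Fin d => Finset.Icc 1 (τ + 1 + d - 1)).filter
      fun l => ∑ j, l j ≤ τ + 1 + d - 1
  have hs : ∀ l ∈ s, ∑ j, l j ∈ Finset.range (τ + d + 1) := fun l hl =>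
    Finset.mem_range.2 (by have := (Finset.mem_filter.1 hl).2; omega)
  calc ∑ l ∈ s, (Fintype.piFinset fun j => dyadicDesign (l j)).card
      ≤ ∑ l ∈ s, 2 ^ (∑ j, l j) := by
        refine Finset.sum_le_sum fun l _ => ?_
        rw [Fintype.card_piFinset, ← Finset.prod_pow_eq_pow_sum]
        exact Finset.prod_le_prod' fun j _ => (card_dyadicDesign (l j)).trans_le (Nat.sub_le _ _)
    _ ≤ ∑ m ∈ Finset.range (τ + d + 1), (m + 1) ^ (d - 1) * 2 ^ m :=
        sum_apply_sum_le hs fun m => Nat.zero_le _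
    _ ≤ ∑ m ∈ Finset.range (τ + d + 1), (τ + d + 1) ^ (d - 1) * 2 ^ m :=
        Finset.sum_le_sum fun m hm => Nat.mul_le_mul_right _
          (Nat.pow_le_pow_left (Finset.mem_range.1 hm) _)
    _ ≤ _ := by
        rw [← Finset.mul_sum]
        exact Nat.mul_le_mul_left _ (Nat.geomSum_lt le_rfl fun _ => Finset.mem_range.1).le

theorem two_pow_sub_one_le_card_sparseGrid (hd : 1 ≤ d) (hτ : 1 ≤ τ) :
    2 ^ τ - 1 ≤ (sparseGrid d τ).card := by
  obtain ⟨e, rfl⟩ := Nat.exists_eq_add_of_le' hd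
  rw [← card_dyadicDesign]
  refine Finset.card_le_card_of_injOn (fun t => Fin.cons t fun _ => 1 / 2) (fun t ht => ?_)
    fun t _ t' _ h => congrFun h 0
  refine mem_sparseGrid_of_sum_lt (l := Fin.cons (τ - 1) fun _ => 0) ?_
    (Fin.cases ?_ fun _ => half_mem_dyadicDesign_one)
  · simpa only [Fin.sum_cons, Finset.sum_const_zero, add_zero] using Nat.sub_one_lt_of_le hτ le_rfl
  · simpa only [Fin.cons_zero, Nat.sub_add_cancel hτ] using Finset.mem_coe.1 ht

theorem half_pow_le_of_lt_card_sparseGrid_succ (hn : 0 < n) (h : n < (sparseGrid d (τ + 1)).card) :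
    (1 / 2 : ℝ) ^ τ
      ≤ ((d : ℝ) + 1) ^ (d - 1) * 2 ^ (d + 1) * ((τ : ℝ) + 1) ^ (d - 1) * (n : ℝ)⁻¹ := by
  have hle : n ≤ ((d + 1) * (τ + 1)) ^ (d - 1) * 2 ^ (τ + d + 1) :=
    (h.le.trans (card_sparseGrid_succ_le d τ)).trans
      (Nat.mul_le_mul_right _ (Nat.pow_le_pow_left (by nlinarith) _))
  have hleR : (n : ℝ) ≤ (((d : ℝ) + 1) * (τ + 1)) ^ (d - 1) * 2 ^ (τ + d + 1) := by
    exact_mod_cast hle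
  rw [← div_eq_mul_inv, le_div_iff₀ (by exact_mod_cast hn)]
  calc (1 / 2 : ℝ) ^ τ * n
      ≤ (1 / 2) ^ τ * ((((d : ℝ) + 1) * (τ + 1)) ^ (d - 1) * 2 ^ (τ + d + 1)) := by gcongr
    _ = (1 / 2 * 2) ^ τ * (((d : ℝ) + 1) ^ (d - 1) * 2 ^ (d + 1) * ((τ : ℝ) + 1) ^ (d - 1)) := by
        rw [mul_pow, mul_pow, add_assoc, pow_add]
        ring
    _ = _ := by norm_num

theorem add_one_le_five_mul_log (hn : 3 ≤ n) (h : 2 ^ τ - 1 ≤ n) :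
    (τ : ℝ) + 1 ≤ 5 * Real.log n := by
  have hn3 : (3 : ℝ) ≤ n := by exact_mod_cast hn
  have hpow : (2 : ℝ) ^ τ ≤ (n : ℝ) ^ 2 := by
    have : 2 ^ τ ≤ n + 1 := by omega
    exact_mod_cast this.trans (by nlinarith)
  have hlog : τ * Real.log 2 ≤ 2 * Real.log n := by
    simpa only [Real.log_pow, Nat.cast_ofNat] using Real.log_le_log (by positivity) hpow
  have hone : 1 ≤ Real.log n := by
    rw [Real.le_log_iff_exp_le (by linarith)]
    linarith [Real.exp_one_lt_d9]
  nlinarith [Real.log_two_gt_d9, Nat.cast_nonneg (α := ℝ) τ]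

end SparseGrid

section OrthogonalProjection

variable {α ι H : Type*} [NormedAddCommGroup H] [InnerProductSpace ℝ H]

theorem norm_sum_sq_of_pairwise_inner_eq_zero {s : Finset ι} {f : ι → H}
    (hf : (s : Set ι).Pairwise fun i j => inner ℝ (f i) (f j) = 0) :
    ‖∑ i ∈ s, f i‖ ^ 2 = ∑ i ∈ s, ‖f i‖ ^ 2 := by
  simp only [← real_inner_self_eq_norm_sq, sum_inner]
  refine Finset.sum_congr rfl fun i hi => ?_
  rw [inner_sum, Finset.sum_eq_single_of_mem i hi fun j hj hji => hf hi hj hji.symm]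

theorem norm_sub_starProjection_le (V : Submodule ℝ H) [V.HasOrthogonalProjection] (y : H) {v : H}
    (hv : v ∈ V) : ‖y - V.starProjection y‖ ≤ ‖y - v‖ := by
  rw [Submodule.starProjection_minimal]
  exact ciInf_le ⟨0, Set.forall_mem_range.2 fun _ => norm_nonneg _⟩ (⟨v, hv⟩ : V)

theorem norm_starProjection_sub_starProjection_le {U V : Submodule ℝ H} [U.HasOrthogonalProjection]
    [V.HasOrthogonalProjection] (hUV : U ≤ V) (y : H) {v : H} (hv : v ∈ U) :
    ‖V.starProjection y - U.starProjection y‖ ≤ ‖y - v‖ := by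
  have hU : V.starProjection (U.starProjection y) = U.starProjection y :=
    Submodule.starProjection_eq_self_iff.2 (hUV (Submodule.starProjection_apply_mem U y))
  calc ‖V.starProjection y - U.starProjection y‖ = ‖V.starProjection (y - U.starProjection y)‖ := by
        rw [map_sub, hU]
    _ ≤ ‖y - U.starProjection y‖ := Submodule.norm_starProjection_apply_le _ _
    _ ≤ ‖y - v‖ := norm_sub_starProjection_le U y hv

theorem inner_starProjection_sub_eq_zero {V : ℕ → Submodule ℝ H}
    [∀ l, (V l).HasOrthogonalProjection] (hV : Monotone V) (y : H) {l m : ℕ} (hlm : l ≠ m) :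
    inner ℝ ((V (l + 1)).starProjection y - (V l).starProjection y)
      ((V (m + 1)).starProjection y - (V m).starProjection y) = 0 := by
  wlog h : l < m generalizing l m
  · rw [real_inner_comm]
    exact this hlm.symm (by omega)
  have hmem : (V (l + 1)).starProjection y - (V l).starProjection y ∈ V m :=
    Submodule.sub_mem _ (hV h (Submodule.starProjection_apply_mem _ _))
      (hV h.le (Submodule.starProjection_apply_mem _ _))
  rw [← sub_sub_sub_cancel_left ((V m).starProjection y) _ y, inner_sub_right,
    Submodule.inner_right_of_mem_orthogonal hmem (Submodule.sub_starProjection_mem_orthogonal y),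
    Submodule.inner_right_of_mem_orthogonal (hV (Nat.le_succ m) hmem)
      (Submodule.sub_starProjection_mem_orthogonal y), sub_zero]

theorem exists_coeff_starProjection (φ : α → H) (s : Set α)
    [(Submodule.span ℝ (φ '' s)).HasOrthogonalProjection] (x : α) :
    ∃ w ∈ Finsupp.supported ℝ ℝ s,
      Finsupp.linearCombination ℝ φ w = (Submodule.span ℝ (φ '' s)).starProjection (φ x) ∧
        (x ∈ s → w = Finsupp.single x 1) := by
  by_cases hx : x ∈ s
  · refine ⟨Finsupp.single x 1, Finsupp.single_mem_supported ℝ 1 hx, ?_, fun _ => rfl⟩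
    rw [Finsupp.linearCombination_single, one_smul, Submodule.starProjection_eq_self_iff.2
      (Submodule.subset_span (Set.mem_image_of_mem φ hx))]
  · obtain ⟨w, hw, hwx⟩ := (Finsupp.mem_span_image_iff_linearCombination ℝ).1
      (Submodule.starProjection_apply_mem (Submodule.span ℝ (φ '' s)) (φ x))
    exact ⟨w, hw, hwx, fun h => absurd h hx⟩

-- The coefficients are those of the successive differences of the orthogonal projections of `φ x`
-- onto the spans of the images of the `S l`.
theorem exists_hierarchical_coeff (φ : α → H) {S : ℕ → Set α} (hS : Monotone S)
    (hfin : ∀ l, (S l).Finite) (hS0 : S 0 = ∅) {n : ℕ} {x : α} (hx : x ∈ S n) :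
    ∃ c : ℕ → α →₀ ℝ, (∀ l, c l ∈ Finsupp.supported ℝ ℝ (S (l + 1))) ∧
      ∑ l ∈ Finset.range n, c l = Finsupp.single x 1 ∧
      (Pairwise fun l m => inner ℝ (Finsupp.linearCombination ℝ φ (c l))
        (Finsupp.linearCombination ℝ φ (c m)) = 0) ∧
      ∀ l, ∀ v ∈ Submodule.span ℝ (φ '' S l),
        ‖Finsupp.linearCombination ℝ φ (c l)‖ ≤ ‖φ x - v‖ := by
  have hfinDim : ∀ l, FiniteDimensional ℝ (Submodule.span ℝ (φ '' S l)) := fun l =>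
    FiniteDimensional.span_of_finite ℝ ((hfin l).image φ)
  have hmono : Monotone fun l => Submodule.span ℝ (φ '' S l) := fun _ _ h =>
    Submodule.span_mono (Set.image_mono (hS h))
  choose w hwS hwφ hwx using fun l => exists_coeff_starProjection φ (S l) x
  have hw0 : w 0 = 0 := by simpa [hS0] using hwS 0
  refine ⟨fun l => w (l + 1) - w l, fun l => ?_, ?_, fun l m hlm => ?_, fun l v hv => ?_⟩
  · exact Submodule.sub_mem _ (hwS (l + 1)) (Finsupp.supported_mono (hS (Nat.le_succ l)) (hwS l))
  · rw [Finset.sum_range_sub, hw0, sub_zero, hwx n hx]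
  · simp only [map_sub, hwφ]
    exact inner_starProjection_sub_eq_zero hmono (φ x) hlm
  · simp only [map_sub, hwφ]
    exact norm_starProjection_sub_starProjection_le (hmono (Nat.le_succ l)) (φ x) hv

theorem exists_dyadic_hierarchical_coeff {φ : ℝ → H} {M x : ℝ} (hx : x ∈ Set.Ioo (0 : ℝ) 1)
    (hM : ‖φ x‖ ^ 2 ≤ M) (hφ : ∀ a ∈ Set.Ioo (0 : ℝ) 1, ‖φ x - φ a‖ ^ 2 ≤ M * |x - a|) (τ : ℕ) :
    ∃ c : ℕ → ℝ →₀ ℝ, (∀ l < τ, ∀ a, c l a ≠ 0 → a ∈ dyadicDesign (l + 1)) ∧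
      ∑ l ∈ Finset.range (τ + 1), c l = Finsupp.single x 1 ∧
      (Pairwise fun l m => inner ℝ (Finsupp.linearCombination ℝ φ (c l))
        (Finsupp.linearCombination ℝ φ (c m)) = 0) ∧
      ∀ l, ‖Finsupp.linearCombination ℝ φ (c l)‖ ^ 2 ≤ M * (1 / 2) ^ l := by
  let S : ℕ → Set ℝ := fun l => ↑(dyadicDesign l) ∪ {a | a = x ∧ τ < l}
  have hS : Monotone S := fun l m hlm => Set.union_subset_union
    (Finset.coe_subset.2 (dyadicDesign_mono hlm)) fun a ha => ⟨ha.1, ha.2.trans_le hlm⟩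
  have hfin : ∀ l, (S l).Finite := fun l => (dyadicDesign l).finite_toSet.union
    ((Set.finite_singleton x).subset fun a ha => ha.1)
  obtain ⟨c, hcS, hcx, horth, hle⟩ := exists_hierarchical_coeff φ hS hfin
    (by simp [S, dyadicDesign_zero]) (n := τ + 1) (x := x) (Or.inr ⟨rfl, Nat.lt_succ_self τ⟩)
  refine ⟨c, fun l hl a ha => ?_, hcx, horth, fun l => ?_⟩
  · rcases hcS l (Finsupp.mem_support_iff.2 ha) with h | h
    · exact h
    · exact absurd h.2 (by omega)
  obtain ⟨v, hv, hvM⟩ : ∃ v ∈ Submodule.span ℝ (φ '' S l), ‖φ x - v‖ ^ 2 ≤ M * (1 / 2) ^ l := by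
    rcases Nat.eq_zero_or_pos l with rfl | hl
    · exact ⟨0, Submodule.zero_mem _, by simpa using hM⟩
    · obtain ⟨a, ha, hxa⟩ := exists_mem_dyadicDesign_abs_sub_le hl hx
      have hM0 : 0 ≤ M := (sq_nonneg _).trans hM
      exact ⟨φ a, Submodule.subset_span ⟨a, Or.inl ha, rfl⟩,
        (hφ a (dyadicDesign_subset_Ioo l ha)).trans (by gcongr)⟩
  exact (pow_le_pow_left₀ (norm_nonneg _) (hle l v hv) 2).trans hvM

end OrthogonalProjection

section TensorFeature

variable {ι : Type*} [Fintype ι] {α : ι → Type*} {E : ι → Type*} [∀ j, NormedAddCommGroup (E j)]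
  [∀ j, InnerProductSpace ℝ (E j)] {H : Type*} [NormedAddCommGroup H] [InnerProductSpace ℝ H]

/-- `ψ` plays the role of the feature map `a ↦ ⨂ j, φ j (a j)` of a product kernel. Only its Gram
kernel is prescribed, so that no Hilbert tensor product is needed and `ψ` may take its values in
any inner product space, such as the `L²` space of a random field. -/
def IsTensorFeature (ψ : (∀ j, α j) → H) (φ : ∀ j, α j → E j) : Prop :=
  ∀ a b, inner ℝ (ψ a) (ψ b) = ∏ j, inner ℝ (φ j (a j)) (φ j (b j))

open Classical in
/-- The combination `∑ a, (∏ j, c j (a j)) • ψ a`, as a multilinear map of the one-dimensional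
coefficients `c j`; for a tensor feature map it stands for `⨂ j, ∑ t, c j t • φ j t`. -/
noncomputable def tensorCombination (ψ : (∀ j, α j) → H) :
    MultilinearMap ℝ (fun j => α j →₀ ℝ) H :=
  (Finsupp.linearCombination ℝ ψ ∘ₗ
    (PiTensorProduct.ofFinsuppEquiv' (R := ℝ) (κ := α)).toLinearMap).compMultilinearMap
      (PiTensorProduct.tprod ℝ)

theorem tensorCombination_single (ψ : (∀ j, α j) → H) (a : ∀ j, α j) :
    tensorCombination ψ (fun j => Finsupp.single (a j) 1) = ψ a := by
  simp [tensorCombination]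

theorem tensorCombination_mem_span {ψ : (∀ j, α j) → H} {s : Set (∀ j, α j)}
    {c : ∀ j, α j →₀ ℝ} (hs : ∀ a : ∀ j, α j, (∀ j, c j (a j) ≠ 0) → a ∈ s) :
    tensorCombination ψ c ∈ Submodule.span ℝ (ψ '' s) := by
  classical
  refine (Finsupp.mem_span_image_iff_linearCombination ℝ).2 ⟨_, fun a ha => hs a ?_, rfl⟩
  simpa [Finset.prod_ne_zero_iff] using ha

variable {ψ : (∀ j, α j) → H} {φ : ∀ j, α j → E j}

theorem IsTensorFeature.inner_tensorCombination (hψ : IsTensorFeature ψ φ)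
    (c c' : ∀ j, α j →₀ ℝ) :
    inner ℝ (tensorCombination ψ c) (tensorCombination ψ c')
      = ∏ j, inner ℝ (Finsupp.linearCombination ℝ (φ j) (c j))
          (Finsupp.linearCombination ℝ (φ j) (c' j)) := by
  classical
  have hsum : ∀ c : ∀ j, α j →₀ ℝ, tensorCombination ψ c
      = ∑ a ∈ Fintype.piFinset fun j => (c j).support, (∏ j, c j (a j)) • ψ a := by
    intro c
    conv_lhs => rw [← funext fun j => Finsupp.sum_single (c j)]
    simp only [Finsupp.sum]
    rw [MultilinearMap.map_sum_finset]
    refine Finset.sum_congr rfl fun a _ => ?_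
    rw [← tensorCombination_single ψ a, ← MultilinearMap.map_smul_univ]
    simp
  simp only [hsum, Finsupp.linearCombination_apply, Finsupp.sum, sum_inner, inner_sum,
    Finset.prod_univ_sum]
  refine Finset.sum_congr rfl fun b _ => Finset.sum_congr rfl fun a _ => ?_
  simp only [real_inner_smul_left, real_inner_smul_right, hψ a b, Finset.prod_mul_distrib]

theorem IsTensorFeature.norm_tensorCombination_sq (hψ : IsTensorFeature ψ φ) (c : ∀ j, α j →₀ ℝ) :
    ‖tensorCombination ψ c‖ ^ 2 = ∏ j, ‖Finsupp.linearCombination ℝ (φ j) (c j)‖ ^ 2 := by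
  simp only [← real_inner_self_eq_norm_sq, hψ.inner_tensorCombination]

theorem IsTensorFeature.norm_sum_tensorCombination_sq {κ : Type*} (hψ : IsTensorFeature ψ φ)
    {c : ∀ j, κ → α j →₀ ℝ} (hc : ∀ j, Pairwise fun l m => inner ℝ
      (Finsupp.linearCombination ℝ (φ j) (c j l)) (Finsupp.linearCombination ℝ (φ j) (c j m)) = 0)
    (s : Finset (ι → κ)) :
    ‖∑ l ∈ s, tensorCombination ψ fun j => c j (l j)‖ ^ 2
      = ∑ l ∈ s, ∏ j, ‖Finsupp.linearCombination ℝ (φ j) (c j (l j))‖ ^ 2 := by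
  simp only [← hψ.norm_tensorCombination_sq]
  refine norm_sum_sq_of_pairwise_inner_eq_zero fun l _ m _ hlm => ?_
  obtain ⟨j, hj⟩ := Function.ne_iff.1 hlm
  rw [hψ.inner_tensorCombination]
  exact Finset.prod_eq_zero (Finset.mem_univ j) (hc j hj)

theorem IsTensorFeature.inner_tensorCombination_apply (hψ : IsTensorFeature ψ φ)
    (c : ∀ j, α j →₀ ℝ) (a : ∀ j, α j) :
    inner ℝ (tensorCombination ψ c) (ψ a)
      = ∏ j, inner ℝ (Finsupp.linearCombination ℝ (φ j) (c j)) (φ j (a j)) := by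
  simpa [tensorCombination_single] using
    hψ.inner_tensorCombination c fun j => Finsupp.single (a j) 1

theorem exists_coeff_inner_eq_zero_of_linearIndepOn {α : Type*} {φ : α → H} {s : Set α}
    (hs : s.Finite) (hφ : LinearIndepOn ℝ φ s) {b : α} (hb : b ∈ s) :
    ∃ c : α →₀ ℝ, (∀ a ∈ s, a ≠ b → inner ℝ (Finsupp.linearCombination ℝ φ c) (φ a) = 0) ∧
      inner ℝ (Finsupp.linearCombination ℝ φ c) (φ b) ≠ 0 := by
  have : FiniteDimensional ℝ (Submodule.span ℝ (φ '' (s \ {b}))) :=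
    FiniteDimensional.span_of_finite ℝ ((hs.subset Set.sdiff_subset).image φ)
  set V := Submodule.span ℝ (φ '' (s \ {b}))
  obtain ⟨w, -, hw, -⟩ := exists_coeff_starProjection φ (s \ {b}) b
  have hu : Finsupp.linearCombination ℝ φ (Finsupp.single b 1 - w)
      = φ b - V.starProjection (φ b) := by simp [hw, V]
  have horth : φ b - V.starProjection (φ b) ∈ Vᗮ := V.sub_starProjection_mem_orthogonal (φ b)
  refine ⟨Finsupp.single b 1 - w, fun a ha hab => ?_, ?_⟩ <;> rw [hu]
  · exact Submodule.inner_left_of_mem_orthogonal (K := V)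
      (Submodule.subset_span (Set.mem_image_of_mem φ ⟨ha, hab⟩)) horth
  · have hself : inner ℝ (φ b - V.starProjection (φ b)) (φ b)
        = ‖φ b - V.starProjection (φ b)‖ ^ 2 := by
      rw [← real_inner_self_eq_norm_sq, inner_sub_right _ (φ b),
        Submodule.inner_left_of_mem_orthogonal (V.starProjection_apply_mem (φ b)) horth, sub_zero]
    rw [hself, pow_ne_zero_iff two_ne_zero, norm_ne_zero_iff, sub_ne_zero]
    exact fun h => hφ.notMem_span hb (h ▸ V.starProjection_apply_mem (φ b))

theorem IsTensorFeature.linearIndepOn (hψ : IsTensorFeature ψ φ) {s : ∀ j, Set (α j)}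
    (hφ : ∀ j, LinearIndepOn ℝ (φ j) (s j)) : LinearIndepOn ℝ ψ (Set.univ.pi s) := by
  refine linearIndepOn_iff.2 fun c hc hc0 => ?_
  by_contra hne
  obtain ⟨b, hb⟩ := Finsupp.support_nonempty_iff.2 hne
  have hsub : ∀ j, (fun a : ∀ j, α j => a j) '' c.support ⊆ s j := by
    rintro j _ ⟨a, ha, rfl⟩
    exact hc ha j (Set.mem_univ j)
  choose e he hne using fun j => exists_coeff_inner_eq_zero_of_linearIndepOn
    (c.support.finite_toSet.image fun a => a j) ((hφ j).mono (hsub j)) (Set.mem_image_of_mem _ hb)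
  have horth : ∀ a ∈ c.support, a ≠ b → inner ℝ (tensorCombination ψ e) (ψ a) = 0 := by
    intro a ha hab
    obtain ⟨j, hj⟩ := Function.ne_iff.1 hab
    rw [hψ.inner_tensorCombination_apply]
    exact Finset.prod_eq_zero (Finset.mem_univ j) (he j _ (Set.mem_image_of_mem _ ha) hj)
  have hzero : c b * inner ℝ (tensorCombination ψ e) (ψ b) = 0 := by
    have h := congrArg (inner ℝ (tensorCombination ψ e)) hc0
    rwa [inner_zero_right, Finsupp.linearCombination_apply, Finsupp.sum, inner_sum,
      Finset.sum_eq_single_of_mem b hb fun a ha hab => by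
        rw [real_inner_smul_right, horth a ha hab, mul_zero], real_inner_smul_right] at h
  rw [hψ.inner_tensorCombination_apply] at hzero
  exact mul_ne_zero (Finsupp.mem_support_iff.1 hb)
    (Finset.prod_ne_zero_iff.2 fun j _ => hne j) hzero

end TensorFeature

section SparseGridApproximation

variable {d : ℕ} {H : Type*} [NormedAddCommGroup H] [InnerProductSpace ℝ H] {E : Fin d → Type*}
  [∀ j, NormedAddCommGroup (E j)] [∀ j, InnerProductSpace ℝ (E j)] {ψ : (Fin d → ℝ) → H}
  {φ : ∀ j, ℝ → E j} {M : Fin d → ℝ} {x : Fin d → ℝ}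

-- Expanding the tensor product of the hierarchical decompositions of the `x j` gives `ψ x` as an
-- orthogonal sum over levels `l`, and the terms with `l 1 + ⋯ + l d < τ` live on the sparse grid.
theorem IsTensorFeature.exists_mem_span_sparseGrid_norm_sub_sq_le (hψ : IsTensorFeature ψ φ)
    (hx : x ∈ openCube d) (hM : ∀ j, ‖φ j (x j)‖ ^ 2 ≤ M j)
    (hφ : ∀ j, ∀ a ∈ Set.Ioo (0 : ℝ) 1, ‖φ j (x j) - φ j a‖ ^ 2 ≤ M j * |x j - a|) (τ : ℕ) :
    ∃ v ∈ Submodule.span ℝ (ψ '' sparseGrid d τ),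
      ‖ψ x - v‖ ^ 2 ≤ (∏ j, M j) * ∑ l ∈ (Fintype.piFinset fun _ : Fin d =>
        Finset.range (τ + 1)).filter (fun l => τ ≤ ∑ j, l j), (1 / 2 : ℝ) ^ (∑ j, l j) := by
  choose c hcS hcx horth hcM using fun j =>
    exists_dyadic_hierarchical_coeff (hx j) (hM j) (hφ j) τ
  set I := Fintype.piFinset fun _ : Fin d => Finset.range (τ + 1)
  set Z : (Fin d → ℕ) → H := fun l => tensorCombination ψ fun j => c j (l j)
  have hexpand : ψ x = ∑ l ∈ I, Z l := by
    rw [← tensorCombination_single ψ x, ← funext hcx, MultilinearMap.map_sum_finset]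
  refine ⟨∑ l ∈ I.filter (fun l => ¬ τ ≤ ∑ j, l j), Z l, ?_, ?_⟩
  · refine Submodule.sum_mem _ fun l hl => tensorCombination_mem_span fun a ha => ?_
    have hlt : ∑ j, l j < τ := not_le.1 (Finset.mem_filter.1 hl).2
    have hj : ∀ j, l j < τ := fun j =>
      (Finset.single_le_sum (fun _ _ => Nat.zero_le _) (Finset.mem_univ j)).trans_lt hlt
    exact mem_sparseGrid_of_sum_lt hlt fun j => hcS j (l j) (hj j) (a j) (ha j)
  · have hrest : ψ x - ∑ l ∈ I.filter (fun l => ¬ τ ≤ ∑ j, l j), Z l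
        = ∑ l ∈ I.filter (fun l => τ ≤ ∑ j, l j), Z l := by
      rw [hexpand, ← Finset.sum_filter_add_sum_filter_not I (fun l => τ ≤ ∑ j, l j),
        add_sub_cancel_right]
    rw [hrest, hψ.norm_sum_tensorCombination_sq horth, Finset.mul_sum]
    refine Finset.sum_le_sum fun l _ => ?_
    calc ∏ j, ‖Finsupp.linearCombination ℝ (φ j) (c j (l j))‖ ^ 2
        ≤ ∏ j, M j * (1 / 2 : ℝ) ^ l j :=
          Finset.prod_le_prod (fun j _ => sq_nonneg _) fun j _ => hcM j (l j)
      _ = (∏ j, M j) * (1 / 2) ^ ∑ j, l j := by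
          rw [Finset.prod_mul_distrib, Finset.prod_pow_eq_pow_sum]

end SparseGridApproximation

section FeatureMap

variable {α H : Type*} [NormedAddCommGroup H] [InnerProductSpace ℝ H] {k : α → α → ℝ} {s : Set α}
  {φ : α → H}

/-- `φ` is a feature map of the kernel `k` on `s`: it realises `k` there as a Gram kernel. -/
def IsFeatureMapOn (k : α → α → ℝ) (s : Set α) (φ : α → H) : Prop :=
  ∀ ⦃a⦄, a ∈ s → ∀ ⦃b⦄, b ∈ s → inner ℝ (φ a) (φ b) = k a b

theorem IsFeatureMapOn.indicator (hφ : IsFeatureMapOn k s φ) :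
    IsFeatureMapOn k s (s.indicator φ) := fun a ha b hb => by
  rw [Set.indicator_of_mem ha, Set.indicator_of_mem hb, hφ ha hb]

theorem IsFeatureMapOn.norm_sq_eq (hφ : IsFeatureMapOn k s φ) {a : α} (ha : a ∈ s) :
    ‖φ a‖ ^ 2 = k a a := by
  rw [← real_inner_self_eq_norm_sq, hφ ha ha]

theorem IsFeatureMapOn.norm_sub_sq_eq (hφ : IsFeatureMapOn k s φ) {a b : α} (ha : a ∈ s)
    (hb : b ∈ s) : ‖φ a - φ b‖ ^ 2 = k a a - 2 * k a b + k b b := by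
  rw [norm_sub_sq_real, hφ.norm_sq_eq ha, hφ.norm_sq_eq hb, hφ ha hb]

-- Extension by zero makes the product formula hold off `Set.univ.pi s` as well.
theorem isTensorFeature_indicator {ι : Type*} [Fintype ι] {α : ι → Type*}
    {E : ι → Type*} [∀ j, NormedAddCommGroup (E j)] [∀ j, InnerProductSpace ℝ (E j)]
    {k : ∀ j, α j → α j → ℝ} {s : ∀ j, Set (α j)} {ψ : (∀ j, α j) → H} {φ : ∀ j, α j → E j}
    (hψ : IsFeatureMapOn (fun a b => ∏ j, k j (a j) (b j)) (Set.univ.pi s) ψ)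
    (hφ : ∀ j, IsFeatureMapOn (k j) (s j) (φ j)) :
    IsTensorFeature ((Set.univ.pi s).indicator ψ) fun j => (s j).indicator (φ j) := by
  intro a b
  by_cases ha : a ∈ Set.univ.pi s
  · by_cases hb : b ∈ Set.univ.pi s
    · rw [hψ.indicator ha hb]
      exact Finset.prod_congr rfl fun j _ => ((hφ j).indicator (ha j trivial) (hb j trivial)).symm
    · obtain ⟨j, hj⟩ : ∃ j, b j ∉ s j := by simpa [Set.mem_pi] using hb
      rw [Set.indicator_of_notMem hb, inner_zero_right, Finset.prod_eq_zero (Finset.mem_univ j)]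
      simp only [Set.indicator_of_notMem hj, inner_zero_right]
  · obtain ⟨j, hj⟩ : ∃ j, a j ∉ s j := by simpa [Set.mem_pi] using ha
    rw [Set.indicator_of_notMem ha, inner_zero_left, Finset.prod_eq_zero (Finset.mem_univ j)]
    simp only [Set.indicator_of_notMem hj, inner_zero_left]

end FeatureMap

section MarkovKernel

variable {α : Type*} [LinearOrder α] {p q : α → ℝ} {s : Set α}

/-- The Markov kernel `p (a ∧ b) * q (a ∨ b)` on a linear order; `tmKernel` is the product of such
kernels on the line. -/
def markovKernel (p q : α → ℝ) (a b : α) : ℝ := p (min a b) * q (max a b)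

theorem markovKernel_comm (p q : α → ℝ) (a b : α) :
    markovKernel p q a b = markovKernel p q b a := by
  rw [markovKernel, markovKernel, min_comm, max_comm]

theorem markovKernel_of_le (p q : α → ℝ) {a b : α} (hab : a ≤ b) :
    markovKernel p q a b = p a * q b := by
  rw [markovKernel, min_eq_left hab, max_eq_right hab]

-- Brownian motion `W` has the indicators of `Ioc 0 t` as features, and `q a * W (p a / q a)` has
-- covariance `markovKernel p q`.
theorem exists_isFeatureMapOn_markovKernel (hp : ∀ a ∈ s, 0 ≤ p a) (hq : ∀ a ∈ s, 0 < q a)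
    (hpq : MonotoneOn (fun a => p a / q a) s) :
    ∃ φ : α → Lp ℝ 2 (volume : Measure ℝ), IsFeatureMapOn (markovKernel p q) s φ := by
  refine ⟨fun a => indicatorConstLp 2 (measurableSet_Ioc (a := (0 : ℝ)) (b := p a / q a))
    measure_Ioc_lt_top.ne (q a), fun a ha b hb => ?_⟩
  wlog hab : a ≤ b generalizing a b
  · rw [real_inner_comm, this b hb a ha (le_of_not_ge hab), markovKernel_comm]
  have hqa := (hq a ha).ne'
  rw [L2.inner_indicatorConstLp_indicatorConstLp _ _ measure_Ioc_lt_top.ne measure_Ioc_lt_top.ne,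
    Set.Ioc_inter_Ioc, Real.volume_real_Ioc, min_eq_left (hpq ha hb hab), sup_idem, sub_zero,
    max_eq_left (div_nonneg (hp a ha) (hq a ha).le), markovKernel_of_le p q hab]
  simp only [smul_eq_mul, RCLike.inner_apply, conj_trivial]
  field_simp

section LinearIndependence

variable {H : Type*} [NormedAddCommGroup H] [InnerProductSpace ℝ H] {φ : α → H}

-- The Markov property: given the value at `y`, the value at `b ≥ y` is uncorrelated with the past.
theorem IsFeatureMapOn.smul_sub_smul_mem_orthogonal (hφ : IsFeatureMapOn (markovKernel p q) s φ)
    {y b : α} (hy : y ∈ s) (hb : b ∈ s) (hyb : y ≤ b) :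
    q y • φ b - q b • φ y ∈ (Submodule.span ℝ (φ '' (s ∩ Set.Iic y)))ᗮ := by
  refine (Submodule.isOrtho_span.2 ?_).symm (Submodule.mem_span_singleton_self _)
  rintro _ ⟨a, ⟨ha, hay⟩, rfl⟩ _ rfl
  rw [inner_sub_right, real_inner_smul_right, real_inner_smul_right, hφ ha hb, hφ ha hy,
    markovKernel_of_le p q hay, markovKernel_of_le p q (le_trans hay hyb)]
  ring

theorem IsFeatureMapOn.notMem_span_markovKernel (hφ : IsFeatureMapOn (markovKernel p q) s φ)
    (hp : ∀ a ∈ s, 0 < p a) (hq : ∀ a ∈ s, 0 < q a)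
    (hpq : StrictMonoOn (fun a => p a / q a) s) {t : Finset α} (ht : ↑t ⊆ s) {b : α} (hb : b ∈ s)
    (htb : ∀ a ∈ t, a < b) : φ b ∉ Submodule.span ℝ (φ '' t) := by
  intro hmem
  have hbb := hφ hb hb
  rw [markovKernel_of_le p q le_rfl] at hbb
  rcases t.eq_empty_or_nonempty with rfl | hne
  · have hzero : φ b = 0 := by simpa using hmem
    rw [hzero, inner_zero_left] at hbb
    exact (mul_pos (hp b hb) (hq b hb)).ne hbb
  · set y := t.max' hne
    have hyt : y ∈ t := t.max'_mem hne
    have hyb : y < b := htb y hyt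
    have hsub : φ '' ↑t ⊆ φ '' (s ∩ Set.Iic y) :=
      Set.image_mono fun a ha => ⟨ht ha, t.le_max' a ha⟩
    have hspan : q y • φ b - q b • φ y ∈ Submodule.span ℝ (φ '' (s ∩ Set.Iic y)) :=
      Submodule.span_mono hsub (Submodule.sub_mem _ (Submodule.smul_mem _ _ hmem)
        (Submodule.smul_mem _ _ (Submodule.subset_span (Set.mem_image_of_mem φ hyt))))
    have hzero : q y • φ b - q b • φ y = 0 := inner_self_eq_zero.1 <|
      Submodule.inner_right_of_mem_orthogonal hspan
        (hφ.smul_sub_smul_mem_orthogonal (ht hyt) hb hyb.le)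
    have hinner := congrArg (fun v => inner ℝ v (φ b)) hzero
    simp only [inner_sub_left, real_inner_smul_left, inner_zero_left, hbb, hφ (ht hyt) hb,
      markovKernel_of_le p q hyb.le] at hinner
    have hlt := hpq (ht hyt) hb hyb
    have hqb := hq b hb
    simp only [div_lt_div_iff₀ (hq y (ht hyt)) hqb] at hlt
    nlinarith [mul_pos (sub_pos.2 hlt) hqb]

theorem IsFeatureMapOn.linearIndepOn_markovKernel (hφ : IsFeatureMapOn (markovKernel p q) s φ)
    (hp : ∀ a ∈ s, 0 < p a) (hq : ∀ a ∈ s, 0 < q a)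
    (hpq : StrictMonoOn (fun a => p a / q a) s) : LinearIndepOn ℝ φ s := by
  refine linearIndepOn_iff_linearIndepOn_finset.2 fun t ht => ?_
  induction t using Finset.induction_on_max with
  | empty => simp
  | insert b t htb ih =>
    rw [Finset.coe_insert] at ht ⊢
    obtain ⟨hb, hts⟩ := Set.insert_subset_iff.1 ht
    exact (ih hts).insert (hφ.notMem_span_markovKernel hp hq hpq hts hb htb)

end LinearIndependence

theorem exists_abs_le_of_lipschitzOnWith {α : Type*} [PseudoMetricSpace α] {s : Set α}
    (hs : Bornology.IsBounded s) {f : α → ℝ} {K : NNReal} (hf : LipschitzOnWith K f s) :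
    ∃ B : ℝ, 0 ≤ B ∧ ∀ a ∈ s, |f a| ≤ B := by
  obtain ⟨g, hg, hfg⟩ := hf.extend_real
  obtain ⟨B, hB, hle⟩ := (hg.isBounded_image hs).exists_pos_norm_le
  exact ⟨B, hB.le, fun a ha => hfg ha ▸ hle (g a) (Set.mem_image_of_mem g ha)⟩

theorem exists_lipschitzOnWith_Ioo {f : ℝ → ℝ} {a b : ℝ} (hf : ContDiffOn ℝ 1 f (Set.Icc a b)) :
    ∃ K, LipschitzOnWith K f (Set.Ioo a b) :=
  (hf.exists_lipschitzOnWith one_ne_zero (convex_Icc a b) isCompact_Icc).imp fun _ hK =>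
    hK.mono Set.Ioo_subset_Icc_self

theorem exists_markovKernel_le {α : Type*} [LinearOrder α] [PseudoMetricSpace α] {p q : α → ℝ}
    {s : Set α} (hs : Bornology.IsBounded s) (hp : ∃ K, LipschitzOnWith K p s)
    (hq : ∃ K, LipschitzOnWith K q s) :
    ∃ M : ℝ, ∀ a ∈ s, markovKernel p q a a ≤ M ∧ ∀ b ∈ s,
      markovKernel p q a a - 2 * markovKernel p q a b + markovKernel p q b b ≤ M * dist a b := by
  obtain ⟨Kp, hKp⟩ := hp
  obtain ⟨Kq, hKq⟩ := hq
  obtain ⟨Bp, hBp0, hBp⟩ := exists_abs_le_of_lipschitzOnWith hs hKp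
  obtain ⟨Bq, hBq0, hBq⟩ := exists_abs_le_of_lipschitzOnWith hs hKq
  refine ⟨Bp * Bq + (Kp * Bq + Bp * Kq), fun a ha => ⟨?_, fun b hb => ?_⟩⟩
  · calc markovKernel p q a a = p a * q a := markovKernel_of_le p q le_rfl
      _ ≤ |p a| * |q a| := (le_abs_self _).trans (abs_mul _ _).le
      _ ≤ Bp * Bq := mul_le_mul (hBp a ha) (hBq a ha) (abs_nonneg _) hBp0
      _ ≤ Bp * Bq + (Kp * Bq + Bp * Kq) := le_add_of_nonneg_right (by positivity)
  · wlog hab : a ≤ b generalizing a b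
    · have h := this b hb a ha (le_of_not_ge hab)
      rw [markovKernel_comm p q b a, dist_comm] at h
      linarith
    have hpab : |p b - p a| ≤ Kp * dist a b := dist_comm a b ▸ hKp.dist_le_mul b hb a ha
    have hqab : |q a - q b| ≤ Kq * dist a b := hKq.dist_le_mul a ha b hb
    calc markovKernel p q a a - 2 * markovKernel p q a b + markovKernel p q b b
        = (p b - p a) * q b + p a * (q a - q b) := by
          simp only [markovKernel_of_le p q hab, markovKernel_of_le p q le_rfl]
          ring
      _ ≤ |p b - p a| * |q b| + |p a| * |q a - q b| := by
          simp only [← abs_mul]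
          exact add_le_add (le_abs_self _) (le_abs_self _)
      _ ≤ Kp * dist a b * Bq + Bp * (Kq * dist a b) := by
          gcongr
          exacts [hBq b hb, hBp a ha]
      _ ≤ (Bp * Bq + (Kp * Bq + Bp * Kq)) * dist a b := by
          have : 0 ≤ Bp * Bq * dist a b := by positivity
          linarith

end MarkovKernel

section Kriging

theorem starProjection_span_image_eq_sum {α H : Type*} [NormedAddCommGroup H]
    [InnerProductSpace ℝ H] {ψ : α → H} {D : Finset α} [DecidableEq D]
    [(Submodule.span ℝ (ψ '' D)).HasOrthogonalProjection] (hli : LinearIndepOn ℝ ψ D) (y : H) :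
    (Submodule.span ℝ (ψ '' D)).starProjection y = ∑ a : D,
      ((fun b : D => inner ℝ y (ψ b)) ᵥ* (Matrix.gram ℝ fun b : D => ψ b)⁻¹) a • ψ a := by
  set G := Matrix.gram ℝ fun b : D => ψ b with hG
  have hdet : IsUnit G.det := (Matrix.det_gram_ne_zero_iff_linearIndependent.2 hli).isUnit
  set w := (fun b : D => inner ℝ y (ψ b)) ᵥ* G⁻¹
  have hw : w ᵥ* G = fun b : D => inner ℝ y (ψ b) := by
    rw [Matrix.vecMul_vecMul, Matrix.nonsing_inv_mul _ hdet, Matrix.vecMul_one]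
  have hmem : ∑ a : D, w a • ψ a ∈ Submodule.span ℝ (ψ '' D) :=
    Submodule.sum_mem _ fun a _ => Submodule.smul_mem _ _
      (Submodule.subset_span (Set.mem_image_of_mem ψ a.2))
  refine Submodule.eq_starProjection_of_mem_orthogonal hmem
    ((Submodule.isOrtho_span.2 ?_).symm (Submodule.mem_span_singleton_self _))
  rintro _ ⟨b, hb, rfl⟩ _ rfl
  rw [real_inner_comm, inner_sub_left, sum_inner, sub_eq_zero, ← congrFun hw ⟨b, hb⟩]
  simp only [hG, Matrix.vecMul, dotProduct, Matrix.gram_apply, real_inner_smul_left]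

variable {d : ℕ} {k : (Fin d → ℝ) → (Fin d → ℝ) → ℝ} {s : Set (Fin d → ℝ)}
  {D : Finset (Fin d → ℝ)} {x : Fin d → ℝ}

/-- The vector `k(x)ᵀ K⁻¹` of the coefficients of the observations in the kriging predictor. -/
noncomputable def krigingWeight (k : (Fin d → ℝ) → (Fin d → ℝ) → ℝ) (D : Finset (Fin d → ℝ))
    (x : Fin d → ℝ) : D → ℝ :=
  (fun a : D => k x a) ᵥ* (kernelMatrix k D)⁻¹

theorem krigingPredictor_eq_sum {Ω : Type*} (k : (Fin d → ℝ) → (Fin d → ℝ) → ℝ)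
    (D : Finset (Fin d → ℝ)) (Y : (Fin d → ℝ) → Ω → ℝ) (x : Fin d → ℝ) (ω : Ω) :
    krigingPredictor k D Y x ω = ∑ a : D, krigingWeight k D x a * Y a ω := by
  rw [krigingPredictor, Matrix.dotProduct_mulVec]
  rfl

theorem IsFeatureMapOn.sum_krigingWeight_smul {H : Type*} [NormedAddCommGroup H]
    [InnerProductSpace ℝ H] {ψ : (Fin d → ℝ) → H}
    [(Submodule.span ℝ (ψ '' D)).HasOrthogonalProjection] (hψ : IsFeatureMapOn k s ψ) (hD : ↑D ⊆ s)
    (hli : LinearIndepOn ℝ ψ D) (hx : x ∈ s) :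
    ∑ a : D, krigingWeight k D x a • ψ a
      = (Submodule.span ℝ (ψ '' D)).starProjection (ψ x) := by
  have hgram : kernelMatrix k D = Matrix.gram ℝ fun a : D => ψ a :=
    Matrix.ext fun a b => (hψ (hD a.2) (hD b.2)).symm
  have hcross : (fun a : D => k x a) = fun a : D => inner ℝ (ψ x) (ψ a) :=
    funext fun a => (hψ hx (hD a.2)).symm
  rw [starProjection_span_image_eq_sum hli, krigingWeight, hgram, hcross]

end Kriging

section SecondOrderProcess

variable {Ω : Type*} [MeasurableSpace Ω] {P : Measure Ω}

theorem exists_isFeatureMapOn_ae_eq {α : Type*} {s : Set α} {k : α → α → ℝ} {Y : α → Ω → ℝ}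
    (hL2 : ∀ a ∈ s, MemLp (Y a) 2 P)
    (hmom : ∀ a ∈ s, ∀ b ∈ s, ∫ ω, Y a ω * Y b ω ∂P = k a b) :
    ∃ ψ : α → Lp ℝ 2 P, IsFeatureMapOn k s ψ ∧ ∀ a ∈ s, ψ a =ᵐ[P] Y a := by
  have hLp : ∀ a, ∃ f : Lp ℝ 2 P, a ∈ s → f =ᵐ[P] Y a := fun a => by
    by_cases ha : a ∈ s
    · exact ⟨(hL2 a ha).toLp (Y a), fun _ => (hL2 a ha).coeFn_toLp⟩
    · exact ⟨0, fun h => absurd h ha⟩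
  choose ψ hψ using hLp
  refine ⟨ψ, fun a ha b hb => ?_, hψ⟩
  rw [L2.inner_def, ← hmom a ha b hb]
  refine integral_congr_ae ?_
  filter_upwards [hψ a ha, hψ b hb] with ω hωa hωb
  rw [hωa, hωb, RCLike.inner_apply, conj_trivial, mul_comm]

theorem lintegral_ofReal_sq_eq_of_ae_eq {f : Lp ℝ 2 P} {g : Ω → ℝ} (hfg : f =ᵐ[P] g) :
    ∫⁻ ω, ENNReal.ofReal (g ω ^ 2) ∂P = ENNReal.ofReal (‖f‖ ^ 2) := by
  have hnorm : ‖f‖ ^ 2 = ∫ ω, f ω ^ 2 ∂P := by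
    rw [← real_inner_self_eq_norm_sq, L2.inner_def]
    simp only [RCLike.inner_apply, conj_trivial, sq]
  rw [hnorm, ofReal_integral_eq_lintegral_ofReal (Lp.memLp f).integrable_sq
    (Filter.Eventually.of_forall fun ω => sq_nonneg _)]
  exact lintegral_congr_ae (hfg.mono fun ω hω => by simp only [hω])

variable {d : ℕ} {Y : (Fin d → ℝ) → Ω → ℝ} {k : (Fin d → ℝ) → (Fin d → ℝ) → ℝ}
  {s : Set (Fin d → ℝ)} {ψ : (Fin d → ℝ) → Lp ℝ 2 P} {D : Finset (Fin d → ℝ)} {x : Fin d → ℝ}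

theorem coeFn_sum_krigingWeight_smul (hY : ∀ a ∈ D, ψ a =ᵐ[P] Y a) :
    ⇑(∑ a : D, krigingWeight k D x a • ψ a) =ᵐ[P] krigingPredictor k D Y x := by
  have hterm : ∀ᵐ ω ∂P, ∀ a : D, (krigingWeight k D x a • ψ a : Lp ℝ 2 P) ω
      = krigingWeight k D x a * Y a ω := by
    refine ae_all_iff.2 fun a => ?_
    filter_upwards [Lp.coeFn_smul (krigingWeight k D x a) (ψ a), hY a a.2] with ω hsmul hω
    rw [hsmul, Pi.smul_apply, hω, smul_eq_mul]
  filter_upwards [Lp.coeFn_finsetSum Finset.univ fun a : D => krigingWeight k D x a • ψ a, hterm]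
    with ω hsum hω
  rw [hsum, Finset.sum_apply, krigingPredictor_eq_sum]
  exact Finset.sum_congr rfl fun a _ => hω a

theorem krigingMSE_le_norm_sub_sq (hψ : IsFeatureMapOn k s ψ) (hY : ∀ a ∈ s, ψ a =ᵐ[P] Y a)
    (hD : ↑D ⊆ s) (hli : LinearIndepOn ℝ ψ D) (hx : x ∈ s) {v : Lp ℝ 2 P}
    (hv : v ∈ Submodule.span ℝ (ψ '' D)) :
    krigingMSE k D Y P x ≤ ENNReal.ofReal (‖ψ x - v‖ ^ 2) := by
  have : FiniteDimensional ℝ (Submodule.span ℝ (ψ '' D)) :=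
    FiniteDimensional.span_of_finite ℝ (D.finite_toSet.image ψ)
  have herror : ⇑(∑ a : D, krigingWeight k D x a • ψ a - ψ x)
      =ᵐ[P] fun ω => krigingPredictor k D Y x ω - Y x ω := by
    filter_upwards [Lp.coeFn_sub (∑ a : D, krigingWeight k D x a • ψ a) (ψ x),
      coeFn_sum_krigingWeight_smul (k := k) (x := x) fun a ha => hY a (hD ha), hY x hx]
      with ω hsub hpred hω
    rw [hsub, Pi.sub_apply, hpred, hω]
  rw [krigingMSE, lintegral_ofReal_sq_eq_of_ae_eq herror,
    hψ.sum_krigingWeight_smul hD hli hx, norm_sub_rev]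
  exact ENNReal.ofReal_le_ofReal
    (pow_le_pow_left₀ (norm_nonneg _) (norm_sub_starProjection_le _ _ hv) 2)

theorem IsCenteredGP.memLp_two (hY : IsCenteredGP Y k P) (hx : x ∈ openCube d) :
    MemLp (Y x) 2 P :=
  (hY.gaussian.hasGaussianLaw_eval ⟨x, hx⟩).memLp_two

theorem IsCenteredGP.integral_mul [IsProbabilityMeasure P] (hY : IsCenteredGP Y k P)
    {y : Fin d → ℝ} (hx : x ∈ openCube d) (hy : y ∈ openCube d) :
    ∫ ω, Y x ω * Y y ω ∂P = k x y := by
  have hcov := covariance_eq_sub (hY.memLp_two hx) (hY.memLp_two hy)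
  rw [hY.cov_eq x hx y hy, hY.mean_zero x hx, zero_mul, sub_zero] at hcov
  exact hcov.symm

end SecondOrderProcess

section ErrorBound

variable {d : ℕ} {p q : Fin d → ℝ → ℝ} {H : Type*} [NormedAddCommGroup H] [InnerProductSpace ℝ H]
  {ψ : (Fin d → ℝ) → H}

theorem openCube_eq_pi (d : ℕ) : openCube d = Set.univ.pi fun _ => Set.Ioo (0 : ℝ) 1 := by
  ext x
  simp only [openCube, Set.mem_ofPred_eq, Set.mem_univ_pi]

theorem IsTensorMarkov.exists_isTensorFeature (hTM : IsTensorMarkov p q)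
    (hψ : IsFeatureMapOn (tmKernel p q) (openCube d) ψ) :
    ∃ φ : Fin d → ℝ → Lp ℝ 2 (volume : Measure ℝ),
      (∀ j, IsFeatureMapOn (markovKernel (p j) (q j)) (Set.Ioo 0 1) (φ j)) ∧
        IsTensorFeature ((openCube d).indicator ψ) φ := by
  choose φ hφ using fun j => exists_isFeatureMapOn_markovKernel
    (fun a ha => (hTM.p_pos j a ha).le) (hTM.q_pos j) (hTM.strictMono_div j).monotoneOn
  rw [openCube_eq_pi] at hψ ⊢
  exact ⟨_, fun j => (hφ j).indicator,
    isTensorFeature_indicator (k := fun j => markovKernel (p j) (q j)) hψ hφ⟩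

theorem IsTensorMarkov.linearIndepOn (hTM : IsTensorMarkov p q)
    (hψ : IsFeatureMapOn (tmKernel p q) (openCube d) ψ) : LinearIndepOn ℝ ψ (openCube d) := by
  obtain ⟨φ, hφ, htensor⟩ := hTM.exists_isTensorFeature hψ
  refine LinearIndepOn.congr ?_ (Set.eqOn_indicator (f := ψ))
  conv_rhs => rw [openCube_eq_pi]
  exact htensor.linearIndepOn fun j =>
    (hφ j).linearIndepOn_markovKernel (hTM.p_pos j) (hTM.q_pos j) (hTM.strictMono_div j)

theorem IsTensorMarkov.exists_mem_span_sparseGrid_norm_sub_sq_le (hTM : IsTensorMarkov p q)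
    (hp : ∀ j, ∃ K, LipschitzOnWith K (p j) (Set.Ioo 0 1))
    (hq : ∀ j, ∃ K, LipschitzOnWith K (q j) (Set.Ioo 0 1))
    (hψ : IsFeatureMapOn (tmKernel p q) (openCube d) ψ) :
    ∃ C : ℝ, 0 ≤ C ∧ ∀ τ : ℕ, ∀ x ∈ openCube d, ∃ v ∈ Submodule.span ℝ (ψ '' sparseGrid d τ),
      ‖ψ x - v‖ ^ 2 ≤ C * ((τ : ℝ) + 1) ^ (d - 1) * (1 / 2) ^ τ := by
  obtain ⟨φ, hφ, htensor⟩ := hTM.exists_isTensorFeature hψ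
  choose M hM using fun j => exists_markovKernel_le (Metric.isBounded_Ioo 0 1) (hp j) (hq j)
  have hnorm : ∀ j, ∀ a ∈ Set.Ioo (0 : ℝ) 1, ‖φ j a‖ ^ 2 ≤ M j := fun j a ha =>
    (hφ j).norm_sq_eq ha ▸ (hM j a ha).1
  have hdist : ∀ j, ∀ a ∈ Set.Ioo (0 : ℝ) 1, ∀ b ∈ Set.Ioo (0 : ℝ) 1,
      ‖φ j a - φ j b‖ ^ 2 ≤ M j * |a - b| := fun j a ha b hb =>
    (hφ j).norm_sub_sq_eq ha hb ▸ (hM j a ha).2 b hb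
  have hM0 : 0 ≤ ∏ j, M j := Finset.prod_nonneg fun j _ =>
    (sq_nonneg _).trans (hnorm j (1 / 2) (by norm_num))
  obtain ⟨C, hC0, hC⟩ := exists_sum_half_pow_sum_le d
  refine ⟨(∏ j, M j) * C, mul_nonneg hM0 hC0, fun τ x hx => ?_⟩
  obtain ⟨v, hv, hvle⟩ := htensor.exists_mem_span_sparseGrid_norm_sub_sq_le hx
    (fun j => hnorm j _ (hx j)) (fun j => hdist j _ (hx j)) τ
  rw [Set.image_congr fun a ha => Set.indicator_of_mem (sparseGrid_subset_openCube d τ ha) ψ] at hv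
  rw [Set.indicator_of_mem hx] at hvle
  refine ⟨v, hv, hvle.trans ?_⟩
  rw [mul_assoc, mul_assoc, ← mul_assoc C]
  exact mul_le_mul_of_nonneg_left (hC τ _ fun l hl => (Finset.mem_filter.1 hl).2) hM0

theorem exists_krigingMSE_le_of_sparseGrid_subset {Ω : Type*} [MeasurableSpace Ω] {P : Measure Ω}
    {Y : (Fin d → ℝ) → Ω → ℝ} (hTM : IsTensorMarkov p q)
    (hp : ∀ j, ∃ K, LipschitzOnWith K (p j) (Set.Ioo 0 1))
    (hq : ∀ j, ∃ K, LipschitzOnWith K (q j) (Set.Ioo 0 1))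
    (hL2 : ∀ x ∈ openCube d, MemLp (Y x) 2 P)
    (hmom : ∀ x ∈ openCube d, ∀ x' ∈ openCube d, ∫ ω, Y x ω * Y x' ω ∂P = tmKernel p q x x') :
    ∃ C : ℝ, 0 ≤ C ∧ ∀ (τ : ℕ) (D : Finset (Fin d → ℝ)), sparseGrid d τ ⊆ D →
      (D : Set (Fin d → ℝ)) ⊆ openCube d → ∀ x ∈ openCube d, krigingMSE (tmKernel p q) D Y P x
        ≤ ENNReal.ofReal (C * ((τ : ℝ) + 1) ^ (d - 1) * (1 / 2) ^ τ) := by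
  obtain ⟨ψ, hψ, hψY⟩ := exists_isFeatureMapOn_ae_eq hL2 hmom
  obtain ⟨C, hC0, hC⟩ := hTM.exists_mem_span_sparseGrid_norm_sub_sq_le hp hq hψ
  refine ⟨C, hC0, fun τ D hτD hD x hx => ?_⟩
  obtain ⟨v, hv, hvle⟩ := hC τ x hx
  exact (krigingMSE_le_norm_sub_sq hψ hψY hD ((hTM.linearIndepOn hψ).mono hD) hx
    (Submodule.span_mono (Set.image_mono (Finset.coe_subset.2 hτD)) hv)).trans
      (ENNReal.ofReal_le_ofReal hvle)

theorem exists_sparseGrid_subset_level_rate_le (hd : 1 ≤ d) :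
    ∃ K : ℝ, ∀ n : ℕ, 3 ≤ n → ∀ D : Finset (Fin d → ℝ), IsTruncatedSparseGrid d n D →
      ∃ τ : ℕ, sparseGrid d τ ⊆ D ∧ ((τ : ℝ) + 1) ^ (d - 1) * (1 / 2) ^ τ
        ≤ K * (n : ℝ)⁻¹ * Real.log n ^ (2 * (d - 1)) := by
  set K := ((d : ℝ) + 1) ^ (d - 1) * 2 ^ (d + 1)
  refine ⟨K * 5 ^ (2 * (d - 1)), ?_⟩
  rintro n hn _ ⟨τ, hτ, hle, hlt, A, -, -, rfl⟩
  refine ⟨τ, Finset.subset_union_left, ?_⟩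
  have hpow := half_pow_le_of_lt_card_sparseGrid_succ (by omega) hlt
  have hlog := add_one_le_five_mul_log hn ((two_pow_sub_one_le_card_sparseGrid hd hτ).trans hle)
  calc ((τ : ℝ) + 1) ^ (d - 1) * (1 / 2) ^ τ
      ≤ ((τ : ℝ) + 1) ^ (d - 1) * (K * ((τ : ℝ) + 1) ^ (d - 1) * (n : ℝ)⁻¹) := by gcongr
    _ = K * (n : ℝ)⁻¹ * ((τ : ℝ) + 1) ^ (2 * (d - 1)) := by ring
    _ ≤ K * (n : ℝ)⁻¹ * (5 * Real.log n) ^ (2 * (d - 1)) := by gcongr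
    _ = K * 5 ^ (2 * (d - 1)) * (n : ℝ)⁻¹ * Real.log n ^ (2 * (d - 1)) := by
        rw [mul_pow]
        ring

end ErrorBound

end TensorMarkov

theorem theorem1_general {d : ℕ} (hd : 1 ≤ d) {Ω : Type*} [MeasurableSpace Ω] (P : Measure Ω)
    (p q : Fin d → ℝ → ℝ) (hTM : TensorMarkov.IsTensorMarkov p q)
    (hp : ∀ j, ∃ K, LipschitzOnWith K (p j) (Set.Ioo 0 1))
    (hq : ∀ j, ∃ K, LipschitzOnWith K (q j) (Set.Ioo 0 1)) (Y : (Fin d → ℝ) → Ω → ℝ)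
    (hL2 : ∀ x ∈ TensorMarkov.openCube d, MemLp (Y x) 2 P)
    (hmom : ∀ x ∈ TensorMarkov.openCube d, ∀ x' ∈ TensorMarkov.openCube d,
      ∫ ω, Y x ω * Y x' ω ∂P = TensorMarkov.tmKernel p q x x') :
    ∃ (C : ℝ) (N : ℕ), ∀ n : ℕ, N ≤ n → ∀ D : Finset (Fin d → ℝ),
      TensorMarkov.IsTruncatedSparseGrid d n D →
        (⨆ x ∈ TensorMarkov.openCube d,
            TensorMarkov.krigingMSE (TensorMarkov.tmKernel p q) D Y P x) ≤
          ENNReal.ofReal (C * (n : ℝ)⁻¹ * Real.log n ^ (2 * (d - 1))) := by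
  obtain ⟨C, hC0, hC⟩ :=
    TensorMarkov.exists_krigingMSE_le_of_sparseGrid_subset hTM hp hq hL2 hmom
  obtain ⟨K, hK⟩ := TensorMarkov.exists_sparseGrid_subset_level_rate_le hd
  refine ⟨C * K, 3, fun n hn D hD => iSup₂_le fun x hx => ?_⟩
  obtain ⟨τ, hτD, hτ⟩ := hK n hn D hD
  refine (hC τ D hτD hD.subset_openCube x hx).trans (ENNReal.ofReal_le_ofReal ?_)
  simpa only [mul_assoc] using mul_le_mul_of_nonneg_left hτ hC0

theorem theorem1 {d : ℕ} (hd : 1 ≤ d) {Ω : Type*} [MeasurableSpace Ω]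
    (P : Measure Ω) [IsProbabilityMeasure P] (p q : Fin d → ℝ → ℝ)
    (hTM : TensorMarkov.IsTensorMarkov p q)
    (hSL : TensorMarkov.SturmLiouvilleRegular p q)
    (Y : (Fin d → ℝ) → Ω → ℝ)
    (hY : TensorMarkov.IsCenteredGP Y (TensorMarkov.tmKernel p q) P) :
    ∃ (C : ℝ) (N : ℕ), ∀ n : ℕ, N ≤ n → ∀ D : Finset (Fin d → ℝ),
      TensorMarkov.IsTruncatedSparseGrid d n D →
        (⨆ x ∈ TensorMarkov.openCube d,
            TensorMarkov.krigingMSE (TensorMarkov.tmKernel p q) D Y P x) ≤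
          ENNReal.ofReal (C * (n : ℝ)⁻¹ * Real.log n ^ (2 * (d - 1))) := by
  exact theorem1_general hd P p q hTM
    (fun j => TensorMarkov.exists_lipschitzOnWith_Ioo (hSL.contDiffOn_p j))
    (fun j => TensorMarkov.exists_lipschitzOnWith_Ioo (hSL.contDiffOn_q j)) Y
    (fun _ => hY.memLp_two) fun _ hx _ => hY.integral_mul hx
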